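/- Let $X$ be a non-negative stochastic process on $\mathbb{R}^d$ with continuous sample paths (the storm process), with law $\mathbb{P}_X$ on $\mathbb{X}=C(\mathbb{R}^d)$, let $\Psi$ be a non-negative stochastic process on $\mathbb{R}^d$ with continuous sample paths (the intensity process), and let $\mu_Y>0$ be a constant. Let $N=\sum_i\delta_{(s_i,u_i,X_i)}$ be a Cox process on $\mathbb{S}=\mathbb{R}^d\times(0,\infty]\times\mathbb{X}$ directed by the random measure $$\mathrm{d}\Lambda(s,u,x)=\mu_Y^{-1}\,\Psi(s)\,\mathrm{d}s\,u^{-2}\,\mathrm{d}u\,\mathrm{d}\mathbb{P}_X(x),$$ that is, $N$ is a simple point process which, conditionally on $\Lambda$, is a Poisson process with directing measure $\Lambda$. Let $$Y(t)=\bigvee_i u_i\,X_i(t-s_i)\in[0,\infty],\qquad t\in\mathbb{R}^d,$$ be the associated Cox extremal process, where the supremum is over all points of $N$ (and is $0$ if there are none). If $\Psi$ is strictly stationary, i.e. if for all $h,t_1,\dots,t_n\in\mathbb{R}^d$ the vectors $(\Psi(t_1+h),\dots,\Psi(t_n+h))$ and $(\Psi(t_1),\dots,\Psi(t_n))$ have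 the same distribution, then $Y$ is strictly stationary: for all $h,t_1,\dots,t_n\in\mathbb{R}^d$ the vectors $(Y(t_1+h),\dots,Y(t_n+h))$ and $(Y(t_1),\dots,Y(t_n))$ have the same distribution. -/

import Mathlib

open MeasureTheory ProbabilityTheory Set
open scoped ENNReal

namespace CoxExtremal

/-- The index space `ℝ^d` with its Euclidean norm and Lebesgue measure. -/
abbrev Pt (d : ℕ) : Type := EuclideanSpace ℝ (Fin d)

/-- The path space `𝕏 = C(ℝ^d)` with the topology of locally uniform convergence. -/
abbrev PathSpace (d : ℕ) : Type := C(Pt d, ℝ)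

/-- The path space carries its Borel σ-algebra. -/
instance instMeasurableSpacePathSpace (d : ℕ) : MeasurableSpace (PathSpace d) := borel _

instance instBorelSpacePathSpace (d : ℕ) : BorelSpace (PathSpace d) := ⟨rfl⟩

/-- The severities `u ∈ (0, ∞]`. -/
abbrev Severity : Type := Set.Ioi (0 : ℝ≥0∞)

/-- The state space `𝕊 = ℝ^d × (0, ∞] × 𝕏` of the points `(s, u, x)`. -/
abbrev StormSpace (d : ℕ) : Type := Pt d × Severity × PathSpace d

/-- A random field `Z = (Z t)_{t ∈ ℝ^d}` is (strictly) stationary: for all `h` and all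
`t_1, …, t_n`, the vectors `(Z (t_1 + h), …, Z (t_n + h))` and `(Z t_1, …, Z t_n)` have
the same law. -/
def IsStationary {d : ℕ} {Ω β : Type*} [MeasurableSpace Ω] [MeasurableSpace β]
    (P : Measure Ω) (Z : Pt d → Ω → β) : Prop :=
  ∀ (h : Pt d) (n : ℕ) (t : Fin n → Pt d),
    IdentDistrib (fun ω (i : Fin n) => Z (t i + h) ω) (fun ω (i : Fin n) => Z (t i) ω) P P

/-- A simple counting measure: a sum of unit masses at countably many distinct points. -/
def IsSimpleCounting {S : Type*} [MeasurableSpace S] (ν : Measure S) : Prop :=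
  ∃ A : Set S, A.Countable ∧ ν = Measure.sum (fun p : A => Measure.dirac (p : S))

/-- Boundedly finite measures on `𝕊`. Bounded sets of `𝕊` are those with bounded location and
with severity bounded away from `0`; there is no restriction on the path coordinate, because
the usual Fréchet metric of `C(ℝ^d)` is bounded. -/
def IsBoundedlyFinite {d : ℕ} (ν : Measure (StormSpace d)) : Prop :=
  ∀ (R : ℝ) (c : ℝ≥0∞), 0 < c →
    ν {p | p.1 ∈ Metric.closedBall (0 : Pt d) R ∧ c ≤ (p.2.1 : ℝ≥0∞)} < ∞

/-- A point process on `𝕊`: a measurable map into the boundedly finite simple counting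
measures. (`Measure S` carries the σ-algebra generated by the evaluations `ν ↦ ν B`.) -/
structure IsPointProcess {d : ℕ} {Ω : Type*} [MeasurableSpace Ω]
    (N : Ω → Measure (StormSpace d)) : Prop where
  measurable : Measurable N
  simple : ∀ ω, IsSimpleCounting (N ω)
  boundedlyFinite : ∀ ω, IsBoundedlyFinite (N ω)

/-- `Q` is the law `PP(lam)` of a Poisson process with directing measure `lam`: the count of every
measurable `B` with `lam B < ∞` is Poisson with parameter `lam B`, and the counts of disjoint
measurable sets are jointly independent. -/
structure IsPoissonLaw {S : Type*} [MeasurableSpace S]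
    (Q : Measure (Measure S)) (lam : Measure S) : Prop where
  counts : ∀ B : Set S, MeasurableSet B → lam B < ∞ →
    Q.map (fun ν => ν B) =
      (poissonMeasure (lam B).toNNReal).map (fun k : ℕ => (k : ℝ≥0∞))
  indep : ∀ (n : ℕ) (B : Fin n → Set S), (∀ i, MeasurableSet (B i)) →
    Pairwise (fun i j => Disjoint (B i) (B j)) →
      iIndepFun (fun (i : Fin n) (ν : Measure S) => ν (B i)) Q

/-- `N` is a Cox process directed by the random measure `Lam`: it is a point process and,
conditionally on `Lam = lam`, it is a Poisson process with directing measure `lam`; that is, a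
regular conditional distribution `κ` of `N` given `Lam` satisfies `κ lam = PP(lam)` for almost
every value `lam` of `Lam`. -/
structure IsCoxProcess {d : ℕ} {Ω : Type*} [MeasurableSpace Ω] (P : Measure Ω)
    (N Lam : Ω → Measure (StormSpace d)) : Prop where
  pointProcess : IsPointProcess N
  condPoisson : ∃ κ : Kernel (Measure (StormSpace d)) (Measure (StormSpace d)),
    IsMarkovKernel κ ∧ HasCondDistrib N Lam κ P ∧
      ∀ᵐ ω ∂P, IsPoissonLaw (κ (Lam ω)) (Lam ω)

/-- The measure `u⁻² du` on `(0, ∞]` (without mass at `∞`). -/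
noncomputable def severityMeasure : Measure Severity :=
  ((Measure.comap (Subtype.val : Set.Ioi (0 : ℝ) → ℝ) volume).withDensity
      (fun r => ENNReal.ofReal (((r : ℝ) ^ 2)⁻¹))).map
    (fun r : Set.Ioi (0 : ℝ) => (⟨ENNReal.ofReal (r : ℝ), ENNReal.ofReal_pos.2 r.2⟩ : Severity))

/-- The measure `μ⁻¹ ψ(s) ds u⁻² du dPX(x)` on `𝕊`, for a realization `ψ` of the intensity
process, a scaling constant `μ` and the law `PX` of the storm process. -/
noncomputable def directingMeasure {d : ℕ} (μ : ℝ) (ψ : Pt d → ℝ) (PX : Measure (PathSpace d)) :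
    Measure (StormSpace d) :=
  ENNReal.ofReal μ⁻¹ •
    ((volume : Measure (Pt d)).withDensity (fun s => ENNReal.ofReal (ψ s))).prod
      (severityMeasure.prod PX)

/-- The field `Y(t) = ⋁ u_i x_i(t - s_i)`, the supremum over the points `(s_i, u_i, x_i)` of the
counting measure `ν`, with values in `[0, ∞]`. -/
noncomputable def extremalField {d : ℕ} (ν : Measure (StormSpace d)) (t : Pt d) : ℝ≥0∞ :=
  ⨆ p : {p : StormSpace d // ν {p} ≠ 0},
    (p.1.2.1 : ℝ≥0∞) * ENNReal.ofReal (p.1.2.2 (t - p.1.1))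

end CoxExtremal

open Filter
open scoped Topology

namespace CoxExtremal

/-! ### Avoidance probabilities of Poisson processes -/

/-! All `Y(t_i) ≤ a_i` hold exactly when `N` has no point in the set `B` of storms exceeding some
level `a_i` at `t_i`. Given the intensity, this has probability `exp(-Λ(B))`
(`IsPoissonLaw.measure_avoid`), so the joint distribution function of `Y` is `E exp(-μ⁻¹ ∫ Ψ(s) g(s)
ds)`, where `g(s)` is the mass of the slice of `B` at location `s`. Moving the sites by `h`
translates `g` by `h`; translation invariance of Lebesgue measure moves the shift onto `Ψ`.
Stationarity gives `Ψ(· + h)` and `Ψ` the same law on the product space, and by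
`exists_measurable_lintegral_eq` the integral is a measurable functional for that σ-algebra. Hence
the distribution functions agree. -/

/-- The function `x ↦ exp (-x)` on `[0, ∞]`, with value `0` at `∞`. -/
noncomputable def expNeg (x : ℝ≥0∞) : ℝ≥0∞ :=
  if x = ∞ then 0 else ENNReal.ofReal (Real.exp (-x.toReal))

lemma measurable_expNeg : Measurable expNeg :=
  Measurable.ite (measurableSet_singleton _) measurable_const (by fun_prop)

lemma IsPoissonLaw.measure_avoid_of_lt_top {S : Type*} [MeasurableSpace S]
    {Q : Measure (Measure S)} {lam : Measure S} (hQ : IsPoissonLaw Q lam) {B : Set S}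
    (hB : MeasurableSet B) (hfin : lam B < ∞) :
    Q {ν | ν B = 0} = ENNReal.ofReal (Real.exp (-(lam B).toReal)) := by
  have h := congrArg (fun m : Measure ℝ≥0∞ => m {0}) (hQ.counts B hB hfin)
  beta_reduce at h
  rw [Measure.map_apply (Measure.measurable_coe hB) (measurableSet_singleton _),
    Measure.map_apply (measurable_of_countable _) (measurableSet_singleton _)] at h
  have h0 : (fun k : ℕ => (k : ℝ≥0∞)) ⁻¹' {0} = {0} := by ext k; simp
  rw [h0, poissonMeasure_singleton] at h
  change Q ((fun ν : Measure S => ν B) ⁻¹' {0}) = _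
  rw [h]
  simp [ENNReal.coe_toNNReal_eq_toReal]

/-- A Poisson process with σ-finite directing measure `lam` avoids `B` with probability
`exp (-lam B)`, also when `lam B = ∞`. -/
lemma IsPoissonLaw.measure_avoid {S : Type*} [MeasurableSpace S]
    {Q : Measure (Measure S)} {lam : Measure S} [SigmaFinite lam] (hQ : IsPoissonLaw Q lam)
    {B : Set S} (hB : MeasurableSet B) :
    Q {ν | ν B = 0} = expNeg (lam B) := by
  unfold expNeg
  split_ifs with htop
  -- Poisson counts are prescribed only on sets of finite mass. By σ-finiteness `B` contains sets of
  -- arbitrarily large finite mass, and avoiding `B` forces avoiding each of them.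
  · have hle : ∀ n : ℕ, Q {ν | ν B = 0} ≤ ENNReal.ofReal (Real.exp (-(n : ℝ))) := by
      intro n
      obtain ⟨T, hT, hTB, hnT, hTtop⟩ :=
        Measure.exists_subset_measure_lt_top (μ := lam) hB (r := (n : ℝ≥0∞))
          (by rw [htop]; exact ENNReal.natCast_lt_top n)
      calc Q {ν | ν B = 0} ≤ Q {ν | ν T = 0} :=
            measure_mono fun ν (hν : ν B = 0) => measure_mono_null hTB hν
        _ = ENNReal.ofReal (Real.exp (-(lam T).toReal)) := hQ.measure_avoid_of_lt_top hT hTtop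
        _ ≤ _ := by
            gcongr
            simpa using ENNReal.toReal_mono hTtop.ne hnT.le
    have hlim : Tendsto (fun n : ℕ => ENNReal.ofReal (Real.exp (-(n : ℝ)))) atTop (𝓝 0) := by
      rw [← ENNReal.ofReal_zero]
      exact (ENNReal.continuous_ofReal.tendsto 0).comp
        (Real.tendsto_exp_neg_atTop_nhds_zero.comp tendsto_natCast_atTop_atTop)
    exact le_antisymm (ge_of_tendsto' hlim hle) zero_le
  · exact hQ.measure_avoid_of_lt_top hB (lt_top_iff_ne_top.2 htop)

/-! ### The directing measure -/

/-- An injective measurable map out of a standard Borel space is an embedding. Unlike a general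
pushforward, one along an embedding keeps σ-finiteness, as `severityMeasure` requires. -/
lemma measurableEmbedding_ofReal_Ioi :
    MeasurableEmbedding
      (fun r : Set.Ioi (0 : ℝ) => (⟨ENNReal.ofReal (r : ℝ), ENNReal.ofReal_pos.2 r.2⟩ : Severity)) := by
  have hmeas : Measurable
      (fun r : Set.Ioi (0 : ℝ) =>
        (⟨ENNReal.ofReal (r : ℝ), ENNReal.ofReal_pos.2 r.2⟩ : Severity)) :=
    (ENNReal.measurable_ofReal.comp measurable_subtype_coe).subtype_mk
  have hinj : Function.Injective
      (fun r : Set.Ioi (0 : ℝ) =>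
        (⟨ENNReal.ofReal (r : ℝ), ENNReal.ofReal_pos.2 r.2⟩ : Severity)) := by
    intro r r' h
    have h' := congrArg (fun u : Severity => (u : ℝ≥0∞)) h
    exact Subtype.ext ((ENNReal.ofReal_eq_ofReal_iff r.2.le r'.2.le).1 h')
  have : StandardBorelSpace (Set.Ioi (0 : ℝ)) := measurableSet_Ioi.standardBorel
  exact hmeas.measurableEmbedding hinj

instance : SigmaFinite severityMeasure := by
  have : SigmaFinite (Measure.comap (Subtype.val : Set.Ioi (0 : ℝ) → ℝ) volume) := by
    refine SigmaFinite.of_map _ measurable_subtype_coe.aemeasurable ?_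
    rw [(MeasurableEmbedding.subtype_coe measurableSet_Ioi).map_comap]
    infer_instance
  exact measurableEmbedding_ofReal_Ioi.sigmaFinite_map

instance {d : ℕ} (μ : ℝ) (ψ : Pt d → ℝ) (PX : Measure (PathSpace d)) [SigmaFinite PX] :
    SigmaFinite (directingMeasure μ ψ PX) :=
  SMul.sigmaFinite (Real.toNNReal μ⁻¹)

lemma directingMeasure_apply {d : ℕ} (μ : ℝ) {ψ : Pt d → ℝ} (hψ : Measurable ψ)
    (PX : Measure (PathSpace d)) [SigmaFinite PX] {B : Set (StormSpace d)}
    (hB : MeasurableSet B) :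
    directingMeasure μ ψ PX B = ENNReal.ofReal μ⁻¹ *
      ∫⁻ s, ENNReal.ofReal (ψ s) * severityMeasure.prod PX (Prod.mk s ⁻¹' B) := by
  rw [directingMeasure, Measure.smul_apply, Measure.prod_apply hB,
    lintegral_withDensity_eq_lintegral_mul _ hψ.ennreal_ofReal
      (measurable_measure_prodMk_left hB)]
  rfl

/-! ### Exceedances of the extremal field -/

/-- The points of the storm space whose storm exceeds the level `a i` at some site `t i`. -/
def exceedanceSet {d : ℕ} {ι : Type*} (t : ι → Pt d) (a : ι → ℝ≥0∞) : Set (StormSpace d) :=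
  {p | ∃ i, a i < (p.2.1 : ℝ≥0∞) * ENNReal.ofReal (p.2.2 (t i - p.1))}

lemma measurableSet_exceedanceSet {d : ℕ} {ι : Type*} [Countable ι] (t : ι → Pt d)
    (a : ι → ℝ≥0∞) : MeasurableSet (exceedanceSet t a) := by
  have heq : exceedanceSet t a =
      ⋃ i, {p : StormSpace d | a i < (p.2.1 : ℝ≥0∞) * ENNReal.ofReal (p.2.2 (t i - p.1))} := by
    ext p; simp [exceedanceSet]
  rw [heq]
  refine MeasurableSet.iUnion fun i => measurableSet_lt measurable_const ?_
  refine Measurable.mul (measurable_subtype_coe.comp (measurable_fst.comp measurable_snd)) ?_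
  refine ENNReal.measurable_ofReal.comp ?_
  -- Evaluation is jointly continuous for locally uniform convergence, since `ℝ^d` is locally
  -- compact.
  have heval : Measurable fun q : PathSpace d × Pt d => q.1 q.2 :=
    ContinuousEval.continuous_eval.measurable
  exact heval.comp ((measurable_snd.comp measurable_snd).prodMk (measurable_const.sub measurable_fst))

lemma preimage_exceedanceSet_add {d : ℕ} {ι : Type*} (t : ι → Pt d) (a : ι → ℝ≥0∞) (h s : Pt d) :
    Prod.mk (s + h) ⁻¹' exceedanceSet (fun i => t i + h) a =
      (Prod.mk s ⁻¹' exceedanceSet t a : Set (Severity × PathSpace d)) := by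
  ext p
  simp [exceedanceSet]

/-- All mass sits on the atoms, so the supremum over atoms defining `extremalField` can be read off
from void events. -/
lemma IsSimpleCounting.measure_eq_zero_iff {S : Type*} [MeasurableSpace S]
    [MeasurableSingletonClass S] {ν : Measure S} (hν : IsSimpleCounting ν) {B : Set S}
    (hB : MeasurableSet B) : ν B = 0 ↔ ∀ p, ν {p} ≠ 0 → p ∉ B := by
  refine ⟨fun h p hp hpB => hp (measure_mono_null (singleton_subset_iff.2 hpB) h), fun h => ?_⟩
  obtain ⟨A, hA, rfl⟩ := hν
  have : Countable A := hA.to_subtype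
  rw [Measure.sum_apply _ hB, ENNReal.tsum_eq_zero]
  intro p
  have hp : (p : S) ∉ B := by
    refine h p fun h0 => ?_
    rw [Measure.sum_apply _ (measurableSet_singleton _), ENNReal.tsum_eq_zero] at h0
    simpa using h0 p
  simp [hp]

lemma extremalField_le_iff {d : ℕ} {ι : Type*} [Countable ι] {ν : Measure (StormSpace d)}
    (hν : IsSimpleCounting ν) (t : ι → Pt d) (a : ι → ℝ≥0∞) :
    (∀ i, extremalField ν (t i) ≤ a i) ↔ ν (exceedanceSet t a) = 0 := by
  rw [hν.measure_eq_zero_iff (measurableSet_exceedanceSet t a)]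
  simp only [extremalField, iSup_le_iff, Subtype.forall, exceedanceSet, mem_ofPred_eq, not_exists,
    not_lt]
  exact ⟨fun h p hp i => h i p hp, fun h i p hp => h p hp i⟩

lemma measurable_extremalField {d : ℕ} {Ω : Type*} [MeasurableSpace Ω]
    {N : Ω → Measure (StormSpace d)} (hN : IsPointProcess N) (t : Pt d) :
    Measurable fun ω => extremalField (N ω) t := by
  refine measurable_of_Iic fun a => ?_
  have heq : (fun ω => extremalField (N ω) t) ⁻¹' Iic a =
      {ω | N ω (exceedanceSet (fun _ : Unit => t) (fun _ => a)) = 0} := by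
    ext ω
    simpa using extremalField_le_iff (hN.simple ω) (fun _ : Unit => t) (fun _ => a)
  rw [heq]
  exact (Measure.measurable_coe (measurableSet_exceedanceSet _ _)).comp hN.measurable
    (measurableSet_singleton 0)

/-- The finite-dimensional distribution functions of a Cox extremal process. -/
lemma IsCoxProcess.measure_extremalField_le {d : ℕ} {Ω : Type*} [MeasurableSpace Ω]
    {P : Measure Ω} [IsFiniteMeasure P] {N Lam : Ω → Measure (StormSpace d)}
    (hN : IsCoxProcess P N Lam) [∀ ω, SigmaFinite (Lam ω)] {ι : Type*} [Countable ι]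
    (t : ι → Pt d) (a : ι → ℝ≥0∞) :
    P {ω | ∀ i, extremalField (N ω) (t i) ≤ a i} =
      ∫⁻ ω, expNeg (Lam ω (exceedanceSet t a)) ∂P := by
  obtain ⟨hpp, κ, hκ, hcond, hpois⟩ := hN
  set B := exceedanceSet t a
  have hB : MeasurableSet B := measurableSet_exceedanceSet t a
  have hE : MeasurableSet {ν : Measure (StormSpace d) | ν B = 0} :=
    Measure.measurable_coe hB (measurableSet_singleton 0)
  calc P {ω | ∀ i, extremalField (N ω) (t i) ≤ a i}
      = P ((fun ω => (Lam ω, N ω)) ⁻¹' (univ ×ˢ {ν | ν B = 0})) := by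
        congr 1
        ext ω
        simpa using extremalField_le_iff (hpp.simple ω) t a
    _ = ((P.map Lam) ⊗ₘ κ) (univ ×ˢ {ν | ν B = 0}) := by
        rw [← hcond.map_eq,
          Measure.map_apply_of_aemeasurable hcond.aemeasurable (MeasurableSet.univ.prod hE)]
    _ = ∫⁻ lam, κ lam {ν | ν B = 0} ∂(P.map Lam) := by
        rw [Measure.compProd_apply_prod MeasurableSet.univ hE, Measure.restrict_univ]
    _ = ∫⁻ ω, κ (Lam ω) {ν | ν B = 0} ∂P :=
        lintegral_map' (κ.measurable_coe hE).aemeasurable hcond.aemeasurable_fst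
    _ = ∫⁻ ω, expNeg (Lam ω B) ∂P :=
        lintegral_congr_ae (hpois.mono fun ω hω => hω.measure_avoid hB)

/-! ### Integrals of continuous random fields -/

/-- Integration against a fixed weight, as a functional of the continuous function `ψ`, is
measurable for the product σ-algebra. -/
lemma exists_measurable_lintegral_eq {T : Type*} [PseudoEMetricSpace T] [MeasurableSpace T]
    [OpensMeasurableSpace T] [TopologicalSpace.SeparableSpace T] (m : Measure T) [SFinite m]
    {g : T → ℝ≥0∞} (hg : Measurable g) :
    ∃ F : (T → ℝ) → ℝ≥0∞, Measurable F ∧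
      ∀ ψ, Continuous ψ → F ψ = ∫⁻ s, ENNReal.ofReal (ψ s) * g s ∂m := by
  cases isEmpty_or_nonempty T with
  | inl h => exact ⟨0, measurable_const, fun ψ _ => by simp [Measure.eq_zero_of_isEmpty m]⟩
  | inr h =>
    let e := TopologicalSpace.denseSeq T
    let π : ℕ → SimpleFunc T T := SimpleFunc.nearestPt e
    -- Each approximant reads `ψ` only at points of a dense sequence, which makes it measurable for
    -- the product σ-algebra. The `liminf` is defined for every `ψ` and equals the limit when `ψ` is
    -- continuous.
    refine ⟨fun ψ => ∫⁻ s, liminf (fun n => ENNReal.ofReal (ψ (π n s))) atTop * g s ∂m, ?_, ?_⟩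
    · have heval : ∀ n, Measurable fun q : (T → ℝ) × T => q.1 (π n q.2) := by
        intro n
        have hcount : Measurable fun q : (T → ℝ) × ℕ => q.1 (e q.2) :=
          measurable_from_prod_countable_left fun k => measurable_pi_apply (e k)
        exact hcount.comp (measurable_fst.prodMk
          ((SimpleFunc.nearestPtInd e n).measurable.comp measurable_snd))
      refine Measurable.lintegral_prod_right' (f := fun q : (T → ℝ) × T =>
        liminf (fun n => ENNReal.ofReal (q.1 (π n q.2))) atTop * g q.2) ?_
      exact (Measurable.liminf fun n => (heval n).ennreal_ofReal).mul (hg.comp measurable_snd)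
    · intro ψ hψ
      refine lintegral_congr fun s => ?_
      have hlim : Tendsto (fun n => π n s) atTop (𝓝 s) :=
        SimpleFunc.tendsto_nearestPt ((TopologicalSpace.denseRange_denseSeq T) s)
      exact congrArg (· * g s)
        (((ENNReal.continuous_ofReal.comp hψ).tendsto s).comp hlim).liminf_eq

/-- A stationary field has the same law as its translates, on the product space. -/
lemma IsStationary.identDistrib {d : ℕ} {Ω : Type*} [MeasurableSpace Ω] {P : Measure Ω}
    [IsFiniteMeasure P] {Ψ : Pt d → Ω → ℝ} (hΨ : ∀ s, Measurable (Ψ s))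
    (hstat : IsStationary P Ψ) (h : Pt d) :
    IdentDistrib (fun ω s => Ψ (s + h) ω) (fun ω s => Ψ s ω) P P := by
  refine (identDistrib_iff_forall_finset_identDistrib (X := fun s ω => Ψ (s + h) ω) (Y := Ψ)
    (measurable_pi_lambda _ fun s => hΨ _).aemeasurable
    (measurable_pi_lambda _ fun s => hΨ _).aemeasurable).2 fun I => ?_
  have hmeas : Measurable fun (v : Fin I.card → ℝ) (s : I) => v (I.equivFin s) :=
    measurable_pi_lambda _ fun s => measurable_pi_apply _
  -- Stationarity speaks of tuples indexed by `Fin n`, so the finite set `I` is enumerated.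
  have := (hstat h I.card fun i => (I.equivFin.symm i : Pt d)).comp hmeas
  convert this using 1
  · ext ω s; simp
  · ext ω s; simp

/-- Distribution functions determine finite measures on `[0, ∞]^ι`. -/
lemma measure_pi_ext_of_Iic {ι : Type*} [Finite ι] {m m' : Measure (ι → ℝ≥0∞)}
    [IsFiniteMeasure m] (h : ∀ a, m (Iic a) = m' (Iic a)) : m = m' := by
  refine ext_of_generate_finite (pi univ '' pi univ fun _ : ι => range Iic) ?_
    (IsPiSystem.pi fun _ => isPiSystem_Iic) ?_ ?_
  · refine (generateFrom_eq_pi (fun _ => ?_) fun _ => ?_).symm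
    · rw [BorelSpace.measurable_eq (α := ℝ≥0∞), borel_eq_generateFrom_Iic]
    · exact ⟨fun _ => univ, fun _ => ⟨⊤, Iic_top⟩, iUnion_const _⟩
  · rintro _ ⟨C, hC, rfl⟩
    choose a ha using fun i => hC i (mem_univ i)
    have : pi univ C = Iic a := by rw [← pi_univ_Iic]; congr 1; ext1 i; exact (ha i).symm
    rw [this, h]
  -- Since `∞` is an allowed value, `Iic ⊤` is the whole space and gives equality of total masses.
  · simpa using h ⊤

end CoxExtremal

open CoxExtremal in
theorem mainTheorem8 {d : ℕ}
    -- the storm process: non-negative with continuous sample paths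
    {ΩX : Type*} [MeasurableSpace ΩX] (PrX : Measure ΩX) [IsProbabilityMeasure PrX]
    (X : ΩX → CoxExtremal.PathSpace d) (hX : Measurable X) (hX_nonneg : ∀ ω s, 0 ≤ X ω s)
    -- the intensity process: non-negative with continuous sample paths
    {Ω : Type*} [MeasurableSpace Ω] (P : Measure Ω) [IsProbabilityMeasure P]
    (Ψ : CoxExtremal.Pt d → Ω → ℝ) (hΨ : ∀ s, Measurable (Ψ s))
    (hΨ_cont : ∀ ω, Continuous (fun s => Ψ s ω)) (hΨ_nonneg : ∀ s ω, 0 ≤ Ψ s ω)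
    -- the scaling constant
    (μY : ℝ) (hμY : 0 < μY)
    -- the Cox process on the storm space
    (N : Ω → Measure (CoxExtremal.StormSpace d))
    (hN : CoxExtremal.IsCoxProcess P N
      (fun ω => CoxExtremal.directingMeasure μY (fun s => Ψ s ω) (PrX.map X)))
    -- stationarity of the intensity process
    (hΨ_stat : CoxExtremal.IsStationary P Ψ) :
    CoxExtremal.IsStationary P
      (fun (t : CoxExtremal.Pt d) (ω : Ω) => CoxExtremal.extremalField (N ω) t) := by
  have hPX : IsProbabilityMeasure (PrX.map X) :=
    Measure.isProbabilityMeasure_map hX.aemeasurable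
  intro h n t
  have hmeas : ∀ t : Fin n → Pt d, Measurable fun ω i => extremalField (N ω) (t i) :=
    fun t => measurable_pi_lambda _ fun i => measurable_extremalField hN.pointProcess _
  have hcdf : ∀ (t : Fin n → Pt d) (a : Fin n → ℝ≥0∞),
      P.map (fun ω i => extremalField (N ω) (t i)) (Iic a) =
        ∫⁻ ω, expNeg (ENNReal.ofReal μY⁻¹ * ∫⁻ s, ENNReal.ofReal (Ψ s ω) *
          severityMeasure.prod (PrX.map X) (Prod.mk s ⁻¹' exceedanceSet t a)) ∂P := by
    intro t a
    rw [Measure.map_apply (hmeas t) measurableSet_Iic]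
    refine (hN.measure_extremalField_le t a).trans (lintegral_congr fun ω => ?_)
    rw [directingMeasure_apply μY (hΨ_cont ω).measurable _ (measurableSet_exceedanceSet t a)]
  have : IsFiniteMeasure (P.map fun ω i => extremalField (N ω) (t i + h)) := inferInstance
  refine ⟨(hmeas fun i => t i + h).aemeasurable, (hmeas t).aemeasurable,
    measure_pi_ext_of_Iic fun a => ?_⟩
  obtain ⟨F, hF, hF_eq⟩ := exists_measurable_lintegral_eq (volume : Measure (Pt d))
    (measurable_measure_prodMk_left (ν := severityMeasure.prod (PrX.map X))
      (measurableSet_exceedanceSet t a))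
  rw [hcdf t a]
  refine (hcdf (fun i => t i + h) a).trans ?_
  -- Substituting `s + h` for `s` removes `h` from the slice weight and leaves it in `Ψ`.
  have hshift : ∀ ω, ∫⁻ s, ENNReal.ofReal (Ψ s ω) * severityMeasure.prod (PrX.map X)
        (Prod.mk s ⁻¹' exceedanceSet (fun i => t i + h) a) = F fun s => Ψ (s + h) ω := by
    intro ω
    rw [hF_eq (fun s => Ψ (s + h) ω) ((hΨ_cont ω).comp (continuous_add_const h)),
      ← lintegral_add_right_eq_self _ h]
    simp_rw [preimage_exceedanceSet_add]
  simp_rw [hshift, ← hF_eq _ (hΨ_cont _)]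
  exact ((hΨ_stat.identDistrib hΨ h).comp
    (measurable_expNeg.comp (hF.const_mul (ENNReal.ofReal μY⁻¹)))).lintegral_eq
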